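/- **Tangles.** Link and tangle diagrams are unoriented. A tangle has four ends NW, NE, SW, SE. Let $s+t$ be the tangle sum (the ends NE, SE of $s$ are joined to the ends NW, SW of $t$). Let $0$ be the tangle of two arcs NW–NE and SW–SE, let $\pm1$ be the tangles with a single crossing, and let an integer $n$ also denote the tangle $\pm1\pm\cdots\pm1$ with $|n|$ summands. Let $st$ be Conway's product: reflect the diagram of $s$ in the plane through its NW–SE axis, then add $t$. Let $1*t$ be the link obtained from $t$ by joining NW to NE and SW to SE. A rational number $t\neq 0,\pm1$ has a unique expansion $$|t|=a_m+\cfrac{1}{a_{m-1}+\cfrac{1}{\ddots+\cfrac1{a_1}}},\qquad a_1\ge 2,\quad a_k\ge 1\ (1<k<m),\quad a_m\ge 0,$$ in integers. The rational tangle $t$ is $((a_1a_2)a_3\cdots)a_m$ if $t>0$ and $(((-a_1)(-a_2))(-a_3)\cdots)(-a_m)$ if $t<0$. **Montesinos links.** For an integer $e$ and rational numbers $t_1,\dots,t_p\notin\{0,1,-1\}$ ($p\ge 0$) put $$M(e;t_1,\dots,t_p)=1*(e+t_10+\cdots+t_p0),\qquad \varepsilon=e+\sum_{i=1}^p\left\lfloor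 \frac1{t_i}\right\rfloor,\qquad \widehat{t_i}=\frac{1}{\{1/t_i\}},$$ where $\{x\}=x-\lfloor x\rfloor$; if $1/t_i$ is an integer, then $\{1/t_i\}=0$ and $\widehat{t_i}=\infty$. **Proposition 3.2.** The link $M(e;t_1,\dots,t_p)$ is isotopic to its reduced form $M(\varepsilon;\widehat{t_1},\dots,\widehat{t_p})$, where entries $\widehat{t_i}=\infty$ are omitted. (If no $1/t_i$ is an integer, nothing is omitted.) Isotopy of links is understood as equivalence of their diagrams under planar isotopy and the Reidemeister moves. -/

import Mathlib

/-!
Unoriented link and tangle diagrams in sliced form, Reidemeister equivalence, Conway's tangle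
calculus, and Montesinos links.

A diagram is put in general position with respect to the height function and read from top to
bottom. It is then a finite sequence of slices; each slice has a single critical event (a local
maximum, a local minimum or a crossing), all other strands running vertically.
-/

namespace Montesinos

/-- The elementary events of a sliced diagram, read downwards.
`cap` is a local maximum (two new adjacent strands are born), `cup` is a local minimum (two
adjacent strands are joined). `crossing s` is a crossing of two adjacent strands: for `s = true`
the over-strand has positive slope (it runs from the upper right to the lower left), for
`s = false` it has negative slope (from the upper left to the lower right). -/
inductive Event where
  | cap : Event
  | cup : Event
  | crossing (s : Bool) : Event

/-- Number of strands entering an event from above. -/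
def Event.inputs : Event → ℕ
  | .cap => 0
  | .cup => 2
  | .crossing _ => 2

/-- Number of strands leaving an event below. -/
def Event.outputs : Event → ℕ
  | .cap => 2
  | .cup => 0
  | .crossing _ => 2

/-- A slice: an event that takes place to the right of exactly `pos` vertical strands. -/
structure Slice where
  event : Event
  pos : ℕ

/-- The slices of the word `w`, read downwards, fit together to a diagram with `m` ends at the
top and `n` ends at the bottom. -/
def Fits : List Slice → ℕ → ℕ → Prop
  | [], m, n => m = n
  | a :: w, m, n =>
      a.pos + a.event.inputs ≤ m ∧ Fits w (m - a.event.inputs + a.event.outputs) n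

/-- Sliced diagrams with `m` ends at the top and `n` ends at the bottom. -/
structure Diagram (m n : ℕ) where
  word : List Slice
  fits : Fits word m n

/-- Link diagrams are the diagrams without ends. -/
abbrev LinkDiagram := Diagram 0 0

/-- Conway's tangles: the ends at the top are NW and NE, the ends at the bottom SW and SE. -/
abbrev Tangle := Diagram 2 2

/-! ### Isotopy -/

/-- The local moves between sliced diagrams. The first five are the planar isotopies (vertical
exchange of distant events, straightening of a zigzag, and sliding a strand that crosses one leg
of a maximum or minimum to the other leg), the remaining ones are the three Reidemeister moves. -/
inductive Move : List Slice → List Slice → Prop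
  /-- an event, and an event that is entirely to the right of it, exchange their heights -/
  | exchange (a b : Event) (i d : ℕ) :
      Move [⟨a, i⟩, ⟨b, i + a.outputs + d⟩] [⟨b, i + a.inputs + d⟩, ⟨a, i⟩]
  | zigzagLeft (i : ℕ) : Move [⟨.cap, i⟩, ⟨.cup, i + 1⟩] []
  | zigzagRight (i : ℕ) : Move [⟨.cap, i + 1⟩, ⟨.cup, i⟩] []
  | slideCap (s : Bool) (i : ℕ) :
      Move [⟨.cap, i + 1⟩, ⟨.crossing s, i⟩] [⟨.cap, i⟩, ⟨.crossing (!s), i + 1⟩]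
  | slideCup (s : Bool) (i : ℕ) :
      Move [⟨.crossing s, i⟩, ⟨.cup, i + 1⟩] [⟨.crossing (!s), i + 1⟩, ⟨.cup, i⟩]
  | reidemeisterOneCap (s : Bool) (i : ℕ) : Move [⟨.cap, i⟩, ⟨.crossing s, i⟩] [⟨.cap, i⟩]
  | reidemeisterOneCup (s : Bool) (i : ℕ) : Move [⟨.crossing s, i⟩, ⟨.cup, i⟩] [⟨.cup, i⟩]
  | reidemeisterTwo (s : Bool) (i : ℕ) : Move [⟨.crossing s, i⟩, ⟨.crossing (!s), i⟩] []
  /-- three strands, one of which is above and one of which is below the two others -/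
  | reidemeisterThree (s₁₂ s₁₃ s₂₃ : Bool) (i : ℕ) (h : s₁₃ = s₁₂ ∨ s₁₃ = s₂₃) :
      Move [⟨.crossing s₁₂, i⟩, ⟨.crossing s₁₃, i + 1⟩, ⟨.crossing s₂₃, i⟩]
        [⟨.crossing s₂₃, i + 1⟩, ⟨.crossing s₁₃, i⟩, ⟨.crossing s₁₂, i + 1⟩]

/-- `E` arises from `D` by one local move, performed on consecutive slices. -/
def Step {m n : ℕ} (D E : Diagram m n) : Prop :=
  ∃ u v x y : List Slice, Move x y ∧ D.word = u ++ x ++ v ∧ E.word = u ++ y ++ v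

/-- Isotopy (for tangles: with fixed ends): the equivalence relation generated by planar isotopy
and the Reidemeister moves. -/
def Isotopic {m n : ℕ} (D E : Diagram m n) : Prop :=
  Relation.EqvGen Step D E

/-! ### Basic operations on words -/

/-- Add `k` vertical strands on the left. -/
def shift (k : ℕ) (w : List Slice) : List Slice :=
  w.map fun a => ⟨a.event, k + a.pos⟩

/-- An event seen after reflecting the plane of the diagram in a horizontal line. -/
def Event.flip : Event → Event
  | .cap => .cup
  | .cup => .cap
  | .crossing s => .crossing (!s)

/-- Reflection of the plane of the diagram in a horizontal line, over-strands staying above. -/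
def flip (w : List Slice) : List Slice :=
  (w.map fun a => ⟨a.event.flip, a.pos⟩).reverse

theorem Fits.append {w w' : List Slice} {l m n : ℕ} (h : Fits w l m) (h' : Fits w' m n) :
    Fits (w ++ w') l n := by
  induction w generalizing l with
  | nil => simp only [Fits] at h; subst h; exact h'
  | cons a w ih => exact ⟨h.1, ih h.2⟩

theorem Fits.right {w : List Slice} {m n : ℕ} (k : ℕ) (h : Fits w m n) :
    Fits w (m + k) (n + k) := by
  induction w generalizing m with
  | nil => simp only [Fits] at h ⊢; omega
  | cons a w ih =>
    obtain ⟨h1, h2⟩ := h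
    refine ⟨by omega, ?_⟩
    have h3 := ih h2
    have e : m + k - a.event.inputs + a.event.outputs
        = m - a.event.inputs + a.event.outputs + k := by omega
    rw [e]; exact h3

theorem Fits.shift {w : List Slice} {m n : ℕ} (k : ℕ) (h : Fits w m n) :
    Fits (shift k w) (k + m) (k + n) := by
  induction w generalizing m with
  | nil => simp only [Fits] at h; subst h; rfl
  | cons a w ih =>
    obtain ⟨h1, h2⟩ := h
    have h3 := ih h2
    have e : k + m - a.event.inputs + a.event.outputs
        = k + (m - a.event.inputs + a.event.outputs) := by omega
    refine ⟨by simp only; omega, ?_⟩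
    simp only
    rw [e]; exact h3

theorem Fits.flip {w : List Slice} {m n : ℕ} (h : Fits w m n) : Fits (flip w) n m := by
  induction w generalizing m with
  | nil => exact h.symm
  | cons a w ih =>
    obtain ⟨h1, h2⟩ := h
    have h3 := ih h2
    rw [Montesinos.flip, List.map_cons, List.reverse_cons]
    refine h3.append ?_
    obtain ⟨e, i⟩ := a
    cases e <;> simp only [Fits, Event.inputs, Event.outputs, Event.flip] at h1 ⊢ <;> omega

/-! ### Conway's tangle calculus -/

namespace Tangle

/-- The tangle `0`: an arc from NW to NE and an arc from SW to SE. -/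
def zero : Tangle := ⟨[⟨.cup, 0⟩, ⟨.cap, 0⟩], by simp [Fits, Event.inputs, Event.outputs]⟩

/-- The tangles `1` (for `s = true`) and `-1` (for `s = false`). -/
def unit (s : Bool) : Tangle := ⟨[⟨.crossing s, 0⟩], by simp [Fits, Event.inputs, Event.outputs]⟩

/-- The tangle sum: `t` stands to the right of `s`, the end NE of `s` is joined with the end NW
of `t` by an arc above them and the end SE of `s` with the end SW of `t` by an arc below them. -/
def sum (s t : Tangle) : Tangle :=
  ⟨[⟨.cap, 1⟩] ++ s.word ++ shift 2 t.word ++ [⟨.cup, 1⟩],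
    Fits.append (m := 4)
      (Fits.append (m := 4)
        (Fits.append (m := 4) (by simp [Fits, Event.inputs, Event.outputs]) (s.fits.right 2))
        (t.fits.shift 2))
      (by simp [Fits, Event.inputs, Event.outputs])⟩

/-- Reflection of the diagram in its NW-SE axis, over-strands staying above. It is obtained by
reflecting in the horizontal axis (which exchanges NW with SW and NE with SE) and then turning
by a right angle clockwise: the new end NW is led around the left side to the old SW, the old end
NE around the right side to the new SE. -/
def reflect (s : Tangle) : Tangle :=
  ⟨[⟨.cap, 2⟩] ++ shift 1 (flip s.word) ++ [⟨.cup, 0⟩],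
    Fits.append (m := 4)
      (Fits.append (m := 4) (by simp [Fits, Event.inputs, Event.outputs])
        ((s.fits.flip.shift 1).right 1))
      (by simp [Fits, Event.inputs, Event.outputs])⟩

/-- Conway's tangle product `st`. -/
def prod (s t : Tangle) : Tangle := sum (reflect s) t

/-- The sum of `n` copies of the tangle `1` or of the tangle `-1`; for `n = 0` the tangle `0`. -/
def copies (s : Bool) : ℕ → Tangle
  | 0 => zero
  | 1 => unit s
  | n + 2 => sum (copies s (n + 1)) (unit s)

/-- The integral tangle `a`. -/
def integral (a : ℤ) : Tangle := copies (decide (0 ≤ a)) a.natAbs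

/-- The tangle `a₁a₂…aₘ = ((…(a₁a₂)…)aₘ₋₁)aₘ`, for the list `[aₘ, …, a₂, a₁]`. (The empty list
does not occur below; it gets the tangle `∞`, two vertical strands.) -/
def ofContFrac : List ℤ → Tangle
  | [] => ⟨[], rfl⟩
  | [a] => integral a
  | a :: b :: l => prod (ofContFrac (b :: l)) (integral a)

/-- The vertical closure `1*t`: NW is joined with NE and SW with SE. -/
def closure (t : Tangle) : LinkDiagram :=
  ⟨[⟨.cap, 0⟩] ++ t.word ++ [⟨.cup, 0⟩],
    Fits.append (m := 2)
      (Fits.append (m := 2) (by simp [Fits, Event.inputs, Event.outputs]) t.fits)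
      (by simp [Fits, Event.inputs, Event.outputs])⟩

end Tangle

/-! ### Rational tangles and Montesinos links -/

/-- The quotients `[aₘ, …, a₁]` of the Euclidean algorithm for `α` and `β`. For coprime
`α, β > 0` with `α/β ≠ 1` they are the only expansion `α/β = aₘ + 1/(aₘ₋₁ + 1/(… + 1/a₁))` into
integers with `a₁ ≥ 2`, `aₖ ≥ 1` for `1 < k < m`, and `aₘ ≥ 0`. -/
def quotients : ℕ → ℕ → List ℕ
  | _, 0 => []
  | α, β + 1 => α / (β + 1) :: quotients (β + 1) (α % (β + 1))
termination_by _ β => β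
decreasing_by exact Nat.mod_lt _ (Nat.succ_pos _)

/-- The rational tangle that corresponds to `t`: `a₁…aₘ` if `t = [aₘ, …, a₁]` is positive, and
`(-a₁)…(-aₘ)` if `-t = [aₘ, …, a₁]` is positive. -/
def rationalTangle (t : ℚ) : Tangle :=
  Tangle.ofContFrac
    ((quotients t.num.natAbs t.den).map fun a : ℕ => if 0 < t then (a : ℤ) else -(a : ℤ))

/-- The Montesinos link `M(e; t₁, …, tₚ) = 1*(e + t₁0 + … + tₚ0)`. -/
def montesinos (e : ℤ) (ts : List ℚ) : LinkDiagram :=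
  Tangle.closure
    (ts.foldl (fun s t => Tangle.sum s (Tangle.prod (rationalTangle t) Tangle.zero))
      (Tangle.integral e))

/-- `ε = e + ∑ ⌊1/tᵢ⌋`. -/
def epsilon (e : ℤ) (ts : List ℚ) : ℤ :=
  e + (ts.map fun t => ⌊1 / t⌋).sum

/-- `t̂ = 1/{1/t}` (meaningful if `1/t` is not an integer). -/
def hat (t : ℚ) : ℚ := 1 / Int.fract (1 / t)

end Montesinos

namespace Montesinos

/-! ### Rewriting of words -/

/-! The closure respects isotopy, so it suffices to compare the two tangles before closing.
Reflection of a rational tangle inverts its fraction: `t0` behaves like the number `1/t`. The claim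
is then `1/t = ⌊1/t⌋ + {1/t}` for each summand (`summand_eq`), after which the integers are
collected at the left end of the sum.

For `t > 0` the splitting is the first division of the Euclidean algorithm. For `t < 0` with a
nonzero remainder it also needs `-q/p = -1 + (p - q)/p` (`refl_negFrac_of_lt`), where continued
fractions of opposite signs meet. The bridge is `rot`, which realises `x ↦ -1/x` by three added
crossings and carries the continued fraction of a number to the reflected one of its negative
(`contFrac_neg`).

Collecting the integers requires that a crossing on the left of a rational tangle can be moved to
its right (a flype). Crossings added at the top, on the right and at the bottom give permutations
`x`, `y`, `z` of tangle classes that satisfy the relations of the braid group on four strands. The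
elements `a = x z⁻¹` and `b = y a y⁻¹` fix `0` and `∞`. Conjugating them by `y`, `z` or the inverses
gives words in `a` and `b` again, so the common fixed points are stable under `y` and `z` and
contain every rational tangle. Being fixed by `a` says that a crossing may pass from top to bottom;
reflection gives the statement for left and right (`unit_add_eq`). -/

/-- Two words that fit are isotopic as diagrams. -/
def WordIsotopic (m n : ℕ) (w w' : List Slice) : Prop :=
  ∃ (h : Fits w m n) (h' : Fits w' m n), Isotopic (⟨w, h⟩ : Diagram m n) ⟨w', h'⟩

theorem Isotopic.map {m n m' n' : ℕ} (f : Diagram m n → Diagram m' n')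
    (hf : ∀ D E, Step D E → Isotopic (f D) (f E)) {D E : Diagram m n} (h : Isotopic D E) :
    Isotopic (f D) (f E) := by
  induction h with
  | rel _ _ h => exact hf _ _ h
  | refl _ => exact .refl _
  | symm _ _ _ ih => exact .symm _ _ ih
  | trans _ _ _ _ _ ih ih' => exact .trans _ _ _ ih ih'

theorem Isotopic.append_right {l m n : ℕ} {D E : Diagram l m} (h : Isotopic D E)
    {v : List Slice} (hv : Fits v m n) :
    Isotopic (⟨D.word ++ v, D.fits.append hv⟩ : Diagram l n) ⟨E.word ++ v, E.fits.append hv⟩ := by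
  refine h.map (fun D : Diagram l m => (⟨D.word ++ v, D.fits.append hv⟩ : Diagram l n)) ?_
  rintro D E ⟨u, v', x, y, hm, hD, hE⟩
  exact .rel _ _ ⟨u, v' ++ v, x, y, hm, by simp [hD], by simp [hE]⟩

theorem Isotopic.append_left {l m n : ℕ} {D E : Diagram m n} (h : Isotopic D E)
    {u : List Slice} (hu : Fits u l m) :
    Isotopic (⟨u ++ D.word, hu.append D.fits⟩ : Diagram l n) ⟨u ++ E.word, hu.append E.fits⟩ := by
  refine h.map (fun D : Diagram m n => (⟨u ++ D.word, hu.append D.fits⟩ : Diagram l n)) ?_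
  rintro D E ⟨u', v, x, y, hm, hD, hE⟩
  exact .rel _ _ ⟨u ++ u', v, x, y, hm, by simp [hD], by simp [hE]⟩

theorem Fits.exists_of_append {u v : List Slice} {m n : ℕ} (h : Fits (u ++ v) m n) :
    ∃ k, Fits u m k ∧ Fits v k n := by
  induction u generalizing m with
  | nil => exact ⟨m, rfl, h⟩
  | cons a u ih =>
    obtain ⟨k, hk, hk'⟩ := ih h.2
    exact ⟨k, ⟨h.1, hk⟩, hk'⟩

namespace WordIsotopic

variable {l m n : ℕ}

theorem refl {w : List Slice} (h : Fits w m n) : WordIsotopic m n w w := ⟨h, h, .refl _⟩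

theorem symm {w w' : List Slice} : WordIsotopic m n w w' → WordIsotopic m n w' w :=
  fun ⟨h, h', i⟩ => ⟨h', h, .symm _ _ i⟩

theorem trans {w w' w'' : List Slice} :
    WordIsotopic m n w w' → WordIsotopic m n w' w'' → WordIsotopic m n w w'' :=
  fun ⟨h, _, i⟩ ⟨_, h', i'⟩ => ⟨h, h', .trans _ _ _ i i'⟩

theorem append {u u' v v' : List Slice} :
    WordIsotopic l m u u' → WordIsotopic m n v v' → WordIsotopic l n (u ++ v) (u' ++ v') :=
  fun ⟨hu, hu', i⟩ ⟨hv, hv', j⟩ => ⟨hu.append hv, hu'.append hv',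
    .trans _ _ _ (i.append_right hv) (j.append_left hu')⟩

theorem of_move {x y : List Slice} (h : Move x y) (hx : Fits x m n) (hy : Fits y m n) :
    WordIsotopic m n x y :=
  ⟨hx, hy, .rel _ _ ⟨[], [], x, y, h, by simp, by simp⟩⟩

end WordIsotopic

theorem Move.fits {x y : List Slice} (h : Move x y) {m n : ℕ} (hx : Fits x m n) : Fits y m n := by
  cases h with
  | exchange a b i d =>
    cases a <;> cases b <;> simp only [Fits, Event.inputs, Event.outputs] at hx ⊢ <;> omega
  | _ => simp only [Fits, Event.inputs, Event.outputs] at hx ⊢; omega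

/-- Rewriting of words by those local moves that never need additional strands: whenever the
first word fits, so does the second one. -/
inductive Red : List Slice → List Slice → Prop
  | refl (w : List Slice) : Red w w
  | trans {u v w : List Slice} : Red u v → Red v w → Red u w
  | append {u u' v v' : List Slice} : Red u u' → Red v v' → Red (u ++ v) (u' ++ v')
  | move {x y : List Slice} : Move x y → Red x y
  | exchange_symm (a b : Event) (i d : ℕ) :
      Red [⟨b, i + a.inputs + d⟩, ⟨a, i⟩] [⟨a, i⟩, ⟨b, i + a.outputs + d⟩]
  | slideCap_symm (s : Bool) (i : ℕ) :
      Red [⟨.cap, i⟩, ⟨.crossing (!s), i + 1⟩] [⟨.cap, i + 1⟩, ⟨.crossing s, i⟩]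

instance : Trans Red Red Red := ⟨Red.trans⟩

/-- A fit condition on the initial word yields all the later ones, so chains of rewritings can
ignore the number of strands. -/
theorem Red.wordIsotopic {w w' : List Slice} (h : Red w w') :
    ∀ {m n : ℕ}, Fits w m n → WordIsotopic m n w w' := by
  induction h with
  | refl w => exact fun h => .refl h
  | trans _ _ ih ih' =>
    intro m n h
    have h1 := ih h
    exact h1.trans (ih' h1.2.1)
  | append _ _ ih ih' =>
    intro m n h
    obtain ⟨k, h1, h2⟩ := h.exists_of_append
    exact (ih h1).append (ih' h2)
  | move h => exact fun hx => .of_move h hx (h.fits hx)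
  | exchange_symm a b i d =>
    intro m n h
    refine (WordIsotopic.of_move (.exchange a b i d) ?_ h).symm
    cases a <;> cases b <;> simp only [Fits, Event.inputs, Event.outputs] at h ⊢ <;> omega
  | slideCap_symm s i =>
    intro m n h
    refine (WordIsotopic.of_move (.slideCap s i) ?_ h).symm
    simp only [Fits, Event.inputs, Event.outputs] at h ⊢; omega

/-! ### Compatibility of moves with shifts and reflection -/

theorem Move.shift (k : ℕ) {x y : List Slice} (h : Move x y) :
    Move (shift k x) (shift k y) := by
  cases h with
  | exchange a b i d =>
    simpa [Montesinos.shift, add_assoc] using Move.exchange a b (k + i) d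
  | zigzagLeft i => exact .zigzagLeft (k + i)
  | zigzagRight i => exact .zigzagRight (k + i)
  | slideCap s i => exact .slideCap s (k + i)
  | slideCup s i => exact .slideCup s (k + i)
  | reidemeisterOneCap s i => exact .reidemeisterOneCap s (k + i)
  | reidemeisterOneCup s i => exact .reidemeisterOneCup s (k + i)
  | reidemeisterTwo s i => exact .reidemeisterTwo s (k + i)
  | reidemeisterThree s t r i h => exact .reidemeisterThree s t r (k + i) h

/-- The alternative is needed because upside down the exchange move runs in the opposite direction.
-/
theorem Move.flip {x y : List Slice} (h : Move x y) :
    Move (flip x) (flip y) ∨ Move (Montesinos.flip y) (Montesinos.flip x) := by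
  cases h with
  | exchange a b i d =>
    right
    have e1 (c : Event) : c.flip.inputs = c.outputs := by cases c <;> rfl
    have e2 (c : Event) : c.flip.outputs = c.inputs := by cases c <;> rfl
    simpa [Montesinos.flip, e1, e2] using Move.exchange a.flip b.flip i d
  | zigzagLeft i => exact .inl (.zigzagRight i)
  | zigzagRight i => exact .inl (.zigzagLeft i)
  | slideCap s i =>
    left
    simpa [Montesinos.flip, Event.flip] using Move.slideCup (!s) i
  | slideCup s i =>
    left
    simpa [Montesinos.flip, Event.flip] using Move.slideCap (!s) i
  | reidemeisterOneCap s i => exact .inl (.reidemeisterOneCup (!s) i)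
  | reidemeisterOneCup s i => exact .inl (.reidemeisterOneCap (!s) i)
  | reidemeisterTwo s i =>
    left
    simpa [Montesinos.flip, Event.flip] using Move.reidemeisterTwo s i
  | reidemeisterThree s t r i h =>
    left
    refine .reidemeisterThree (!r) (!t) (!s) i ?_
    rcases h with h | h <;> simp [h]

theorem shift_append (k : ℕ) (u v : List Slice) : shift k (u ++ v) = shift k u ++ shift k v := by
  simp [shift]

theorem shift_nil (k : ℕ) : shift k [] = [] := rfl

theorem shift_cons (k : ℕ) (a : Slice) (u : List Slice) :
    shift k (a :: u) = ⟨a.event, k + a.pos⟩ :: shift k u := rfl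

theorem shift_zero (u : List Slice) : shift 0 u = u := by
  simp [shift]

theorem shift_shift (k l : ℕ) (u : List Slice) : shift k (shift l u) = shift (k + l) u := by
  simp [shift, add_assoc]

theorem flip_nil : flip [] = [] := rfl

theorem flip_cons (a : Slice) (u : List Slice) :
    flip (a :: u) = flip u ++ [⟨a.event.flip, a.pos⟩] := by
  simp [flip]

theorem flip_append (u v : List Slice) : flip (u ++ v) = flip v ++ flip u := by
  simp [flip]

theorem flip_shift (k : ℕ) (u : List Slice) : flip (shift k u) = shift k (flip u) := by
  simp [flip, shift]

theorem shift_eq_append (k : ℕ) {w u x v : List Slice} (h : w = u ++ x ++ v) :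
    shift k w = shift k u ++ shift k x ++ shift k v := by
  rw [h, shift_append, shift_append]

theorem flip_eq_append {w u x v : List Slice} (h : w = u ++ x ++ v) :
    flip w = flip v ++ flip x ++ flip u := by
  rw [h, flip_append, flip_append, List.append_assoc]

theorem Isotopic.shift {m n : ℕ} {D E : Diagram m n} (h : Isotopic D E) (k : ℕ) :
    Isotopic (⟨shift k D.word, D.fits.shift k⟩ : Diagram (k + m) (k + n))
      ⟨Montesinos.shift k E.word, E.fits.shift k⟩ := by
  refine h.map (fun D : Diagram m n => ⟨Montesinos.shift k D.word, D.fits.shift k⟩) ?_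
  rintro D E ⟨u, v, x, y, hm, hD, hE⟩
  exact .rel _ _ ⟨_, _, _, _, hm.shift k, shift_eq_append k hD,
    shift_eq_append k hE⟩

theorem Isotopic.right {m n : ℕ} {D E : Diagram m n} (h : Isotopic D E) (k : ℕ) :
    Isotopic (⟨D.word, D.fits.right k⟩ : Diagram (m + k) (n + k)) ⟨E.word, E.fits.right k⟩ := by
  refine h.map (fun D : Diagram m n => ⟨D.word, D.fits.right k⟩) ?_
  rintro D E ⟨u, v, x, y, hm, hD, hE⟩
  exact .rel _ _ ⟨_, _, _, _, hm, hD, hE⟩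

theorem Isotopic.flip {m n : ℕ} {D E : Diagram m n} (h : Isotopic D E) :
    Isotopic (⟨flip D.word, D.fits.flip⟩ : Diagram n m) ⟨Montesinos.flip E.word, E.fits.flip⟩ := by
  refine h.map (fun D : Diagram m n => ⟨Montesinos.flip D.word, D.fits.flip⟩) ?_
  rintro D E ⟨u, v, x, y, hm, hD, hE⟩
  rcases hm.flip with h | h
  · exact .rel _ _ ⟨_, _, _, _, h, flip_eq_append hD,
      flip_eq_append hE⟩
  · exact .symm _ _ <| .rel _ _ ⟨_, _, _, _, h,
      flip_eq_append hE,
      flip_eq_append hD⟩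

/-! ### Vertical exchange of words -/

namespace Red

theorem under (u : List Slice) {v v' : List Slice} (h : Red v v') : Red (u ++ v) (u ++ v') :=
  .append (.refl u) h

theorem before {u u' : List Slice} (h : Red u u') (v : List Slice) : Red (u ++ v) (u' ++ v) :=
  .append h (.refl v)

theorem lower {e f : Event} {i j j' : ℕ}
    (h : i + e.outputs ≤ j := by simp [Event.outputs, Event.inputs])
    (h' : j' = j - e.outputs + e.inputs := by simp [Event.outputs, Event.inputs]) :
    Red [⟨e, i⟩, ⟨f, j⟩] [⟨f, j'⟩, ⟨e, i⟩] := by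
  obtain ⟨d, rfl⟩ := Nat.exists_eq_add_of_le h
  have : j' = i + e.inputs + d := by omega
  subst this
  exact .move (.exchange e f i d)

theorem lift {e f : Event} {i j j' : ℕ}
    (h : i + e.inputs ≤ j := by simp [Event.outputs, Event.inputs])
    (h' : j' = j - e.inputs + e.outputs := by simp [Event.outputs, Event.inputs]) :
    Red [⟨f, j⟩, ⟨e, i⟩] [⟨e, i⟩, ⟨f, j'⟩] := by
  obtain ⟨d, rfl⟩ := Nat.exists_eq_add_of_le h
  have : j' = i + e.outputs + d := by omega
  subst this
  exact .exchange_symm e f i d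

theorem lower_word {e : Event} {i k k' : ℕ} {w : List Slice}
    (h : i + e.outputs ≤ k := by simp [Event.outputs, Event.inputs])
    (h' : k' = k - e.outputs + e.inputs := by simp [Event.outputs, Event.inputs]) :
    Red ([⟨e, i⟩] ++ shift k w) (shift k' w ++ [⟨e, i⟩]) := by
  induction w with
  | nil => exact .refl _
  | cons f w ih =>
    refine Red.trans (v := [⟨f.event, k' + f.pos⟩] ++ ([⟨e, i⟩] ++ shift k w)) ?_ (ih.under _)
    exact (lower (j := k + f.pos) (by omega) (by omega)).before (shift k w)

theorem lift_word {e : Event} {i k k' : ℕ} {w : List Slice}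
    (h : i + e.inputs ≤ k := by simp [Event.outputs, Event.inputs])
    (h' : k' = k - e.inputs + e.outputs := by simp [Event.outputs, Event.inputs]) :
    Red (shift k w ++ [⟨e, i⟩]) ([⟨e, i⟩] ++ shift k' w) := by
  induction w with
  | nil => exact .refl _
  | cons f w ih =>
    refine (ih.under [⟨f.event, k + f.pos⟩]).trans ?_
    exact (lift (j := k + f.pos) (by omega) (by omega)).before (shift k' w)

/-- The word `w` lies entirely to the right of `u`, so the events of `u` sink below it one by one.
The offset changes by the difference of the numbers of strands above and below `u`. Since `Red` is
not symmetric, `commute_words'` treats the other direction. -/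
theorem commute_words {u : List Slice} {m n : ℕ} (hu : Fits u m n) {i k k' : ℕ} (h : i + n ≤ k)
    (h' : k' = k - n + m) (w : List Slice) :
    Red (shift i u ++ shift k w) (shift k' w ++ shift i u) := by
  induction u generalizing m k' with
  | nil =>
    simp only [Fits] at hu
    obtain rfl : k' = k := by omega
    simpa [shift] using Red.refl (shift k' w)
  | cons a u ih =>
    obtain ⟨h1, h2⟩ := hu
    have h3 := (ih h2 rfl).under [⟨a.event, i + a.pos⟩]
    have h4 := (lower_word (e := a.event) (w := w) (i := i + a.pos) (k' := k')
      (k := k - n + (m - a.event.inputs + a.event.outputs)) (by omega) (by omega)).before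
        (shift i u)
    rw [List.append_assoc, List.append_assoc] at h4
    exact h3.trans h4

theorem commute_words' {u : List Slice} {m n : ℕ} (hu : Fits u m n) {i k k' : ℕ} (h : i + m ≤ k)
    (h' : k' = k - m + n) (w : List Slice) :
    Red (shift k w ++ shift i u) (shift i u ++ shift k' w) := by
  induction u generalizing m k with
  | nil =>
    simp only [Fits] at hu
    obtain rfl : k' = k := by omega
    simpa [shift] using Red.refl (shift k' w)
  | cons a u ih =>
    obtain ⟨h1, h2⟩ := hu
    have h3 := (lift_word (e := a.event) (w := w) (i := i + a.pos) (k := k)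
      (k' := k - a.event.inputs + a.event.outputs) (by omega) (by omega)).before (shift i u)
    have h4 := (ih h2 (k := k - a.event.inputs + a.event.outputs)
      (by omega) (by omega)).under [⟨a.event, i + a.pos⟩]
    rw [List.append_assoc, List.append_assoc] at h3
    exact h3.trans h4

end Red

/-- A local maximum to the right of `i` strands. -/
abbrev capAt (i : ℕ) : Slice := ⟨.cap, i⟩

/-- A local minimum to the right of `i` strands. -/
abbrev cupAt (i : ℕ) : Slice := ⟨.cup, i⟩

/-- A crossing to the right of `i` strands. -/
abbrev crossingAt (s : Bool) (i : ℕ) : Slice := ⟨.crossing s, i⟩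

/-! ### Rewriting words that are composed of blocks -/

namespace Red

variable {u v : List (List Slice)} {p q r p' q' r' : List Slice}

theorem skip (h : Red u.flatten v.flatten) : Red (p :: u).flatten (p :: v).flatten :=
  h.under p

theorem swap (h : Red (p ++ q) (p' ++ q')) : Red (p :: q :: u).flatten (p' :: q' :: u).flatten := by
  simpa using h.before u.flatten

theorem cancel (h : Red (p ++ q) []) : Red (p :: q :: u).flatten u.flatten := by
  simpa using h.before u.flatten

theorem three (h : Red (p ++ (q ++ r)) (p' ++ (q' ++ r'))) :
    Red (p :: q :: r :: u).flatten (p' :: q' :: r' :: u).flatten := by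
  simpa using h.before u.flatten

theorem zigzagLeft {i : ℕ} : Red [capAt i, cupAt (i + 1)] [] := .move (.zigzagLeft i)

theorem zigzagRight {i : ℕ} : Red [capAt (i + 1), cupAt i] [] := .move (.zigzagRight i)

theorem slideCap {s : Bool} {i : ℕ} :
    Red [capAt (i + 1), crossingAt s i] [capAt i, crossingAt (!s) (i + 1)] :=
  .move (.slideCap s i)

theorem slideCap' {s : Bool} {i : ℕ} :
    Red [capAt i, crossingAt s (i + 1)] [capAt (i + 1), crossingAt (!s) i] := by
  simpa using Red.slideCap_symm (!s) i

end Red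

theorem Isotopic.of_red {m n : ℕ} {D E : Diagram m n} {w : List Slice} (h : Red D.word w)
    (h' : Red E.word w) : Isotopic D E := by
  obtain ⟨_, _, i⟩ := h.wordIsotopic D.fits
  obtain ⟨_, _, j⟩ := h'.wordIsotopic E.fits
  exact .trans _ _ _ i (.symm _ _ j)

theorem Isotopic.trans {m n : ℕ} {D E F : Diagram m n} (h : Isotopic D E) (h' : Isotopic E F) :
    Isotopic D F :=
  Relation.EqvGen.trans _ _ _ h h'

/-! ### Conway's operations up to isotopy -/

namespace Tangle

theorem sum_congr {s s' t t' : Tangle} (h : Isotopic s s') (h' : Isotopic t t') :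
    Isotopic (sum s t) (sum s' t') := by
  have hc : Fits [capAt 1] 2 4 := by simp [Fits, Event.inputs, Event.outputs]
  have hd : Fits [cupAt 1] 4 2 := by simp [Fits, Event.inputs, Event.outputs]
  have h1 := (((h.right 2).append_left hc).append_right (t.fits.shift 2)).append_right hd
  have h2 := ((h'.shift 2).append_left (hc.append (s'.fits.right 2))).append_right hd
  exact h1.trans h2

theorem reflect_congr {s s' : Tangle} (h : Isotopic s s') :
    Isotopic (reflect s) (reflect s') := by
  have hc : Fits [capAt 2] 2 4 := by simp [Fits, Event.inputs, Event.outputs]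
  have hd : Fits [cupAt 0] 4 2 := by simp [Fits, Event.inputs, Event.outputs]
  exact (((h.flip.shift 1).right 1).append_left hc).append_right hd

theorem closure_congr {s s' : Tangle} (h : Isotopic s s') :
    Isotopic (closure s) (closure s') := by
  have hc : Fits [capAt 0] 0 2 := by simp [Fits, Event.inputs, Event.outputs]
  have hd : Fits [cupAt 0] 2 0 := by simp [Fits, Event.inputs, Event.outputs]
  exact (h.append_left hc).append_right hd

/-- The vertical composition: `s` stands above `t`. -/
def comp (s t : Tangle) : Tangle := ⟨s.word ++ t.word, s.fits.append t.fits⟩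

theorem comp_congr {s s' t t' : Tangle} (h : Isotopic s s') (h' : Isotopic t t') :
    Isotopic (comp s t) (comp s' t') :=
  (h.append_right t.fits).trans (h'.append_left s'.fits)

/-- The tangle `∞`: two vertical strands. -/
def infty : Tangle := ⟨[], rfl⟩

/-- Reflection of the plane of the diagram in the horizontal axis, over-strands staying above. -/
def flipped (s : Tangle) : Tangle := ⟨flip s.word, s.fits.flip⟩

/-- A tangle has two ends above and two below, so the position of an event to its right does not
change. -/
theorem pass_right (t : Tangle) {e : Event} {k j : ℕ} (h : k + 2 ≤ j := by simp) :
    Red (shift k t.word ++ [⟨e, j⟩]) ([⟨e, j⟩] ++ shift k t.word) := by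
  simpa [shift] using Red.commute_words t.fits h (by omega) [⟨e, 0⟩] (k' := j)

theorem pass_right' (t : Tangle) {e : Event} {k j : ℕ} (h : k + 2 ≤ j := by simp) :
    Red ([⟨e, j⟩] ++ shift k t.word) (shift k t.word ++ [⟨e, j⟩]) := by
  simpa [shift] using Red.commute_words' t.fits h (by omega) [⟨e, 0⟩] (k' := j)

theorem pass_tangle (s t : Tangle) {k j : ℕ} (h : k + 2 ≤ j := by simp) :
    Red (shift k s.word ++ shift j t.word) (shift j t.word ++ shift k s.word) :=
  Red.commute_words s.fits h (by omega) t.word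

theorem pass_tangle' (s t : Tangle) {k j : ℕ} (h : k + 2 ≤ j := by simp) :
    Red (shift j t.word ++ shift k s.word) (shift k s.word ++ shift j t.word) :=
  Red.commute_words' s.fits h (by omega) t.word

open Red in
theorem zero_sum (t : Tangle) : Isotopic (sum zero t) t := by
  refine .of_red ?_ (.refl _)
  calc (sum zero t).word
      = [[capAt 1], [cupAt 0], [capAt 0], shift 2 t.word, [cupAt 1]].flatten := by
        simp [sum, zero]
    Red _ [[capAt 0], shift 2 t.word, [cupAt 1]].flatten := cancel zigzagRight
    Red _ [shift 0 t.word, [capAt 0], [cupAt 1]].flatten := swap lower_word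
    Red _ [shift 0 t.word].flatten := skip (cancel zigzagLeft)
    _ = t.word := by simp [shift_zero]

open Red in
theorem sum_zero (t : Tangle) : Isotopic (sum t zero) t := by
  refine .of_red ?_ (.refl _)
  calc (sum t zero).word
      = [[capAt 1], shift 0 t.word, [cupAt 2], [capAt 2], [cupAt 1]].flatten := by
        simp [sum, zero, shift_cons, shift_nil, shift_zero]
    Red _ [[capAt 1], shift 0 t.word, [cupAt 2]].flatten :=
      skip (skip (skip (cancel zigzagRight)))
    Red _ [[capAt 1], [cupAt 2], shift 0 t.word].flatten :=
      skip (swap t.pass_right)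
    Red _ [shift 0 t.word].flatten := cancel zigzagLeft
    _ = t.word := by simp [shift_zero]

open Red in
theorem sum_assoc (r s t : Tangle) : Isotopic (sum (sum r s) t) (sum r (sum s t)) := by
  refine .of_red (w := [[capAt 1], [capAt 1], shift 0 r.word, shift 2 s.word, shift 4 t.word,
    [cupAt 1], [cupAt 1]].flatten) ?_ ?_
  · calc (sum (sum r s) t).word
        = [[capAt 1], [capAt 1], shift 0 r.word, shift 2 s.word, [cupAt 1], shift 2 t.word,
            [cupAt 1]].flatten := by simp [sum, shift_zero]
      Red _ _ := skip <| skip <| skip <| skip <| swap lower_word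
  · calc (sum r (sum s t)).word
        = [[capAt 1], shift 0 r.word, [capAt 3], shift 2 s.word, shift 4 t.word, [cupAt 3],
            [cupAt 1]].flatten := by
          simp [sum, shift_zero, shift_append, shift_shift, shift_cons, shift_nil]
      Red _ [[capAt 1], [capAt 3], shift 0 r.word, shift 2 s.word, shift 4 t.word, [cupAt 3],
            [cupAt 1]].flatten := skip <| swap r.pass_right
      Red _ [[capAt 1], [capAt 1], shift 0 r.word, shift 2 s.word, shift 4 t.word, [cupAt 3],
            [cupAt 1]].flatten := swap lower
      Red _ [[capAt 1], [capAt 1], shift 0 r.word, shift 2 s.word, shift 4 t.word, [cupAt 1],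
            [cupAt 1]].flatten := skip <| skip <| skip <| skip <| skip <| swap lift

open Red in
theorem reflect_infty : Isotopic (reflect infty) zero :=
  .of_red (w := zero.word) lift (.refl _)

open Red in
theorem reflect_zero : Isotopic (reflect zero) infty := by
  refine .of_red (w := []) ?_ (.refl _)
  calc (reflect zero).word
      = [[capAt 2], [cupAt 1], [capAt 1], [cupAt 0]].flatten := rfl
    Red _ [[capAt 1], [cupAt 0]].flatten := cancel zigzagRight
    Red _ [].flatten := cancel zigzagRight

open Red in
theorem reflect_unit (s : Bool) : Isotopic (reflect (unit s)) (unit s) := by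
  refine .of_red (w := (unit s).word) ?_ (.refl _)
  calc (reflect (unit s)).word
      = [[capAt 2], [crossingAt (!s) 1], [cupAt 0]].flatten := rfl
    Red _ [[capAt 1], [crossingAt (!(!s)) 2], [cupAt 0]].flatten := swap slideCap
    Red _ [[capAt 1], [cupAt 0], [crossingAt (!(!s)) 0]].flatten := skip <| swap lift
    Red _ [[crossingAt (!(!s)) 0]].flatten := cancel zigzagRight
    _ = (unit s).word := by simp [unit]

open Red in
-- The horizontal reflection reverses the vertical order, so the block of `s` has to sink below that
-- of `t`. The arcs that joined the two summands then form two zigzags, which are straightened.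
theorem reflect_comp (s t : Tangle) :
    Isotopic (reflect (comp s t)) (sum (reflect s) (reflect t)) := by
  let s' := flipped s
  let t' := flipped t
  refine .symm _ _ <| Isotopic.of_red (w := (reflect (comp s t)).word) ?_ (.refl _)
  calc (sum (reflect s) (reflect t)).word
      = [[capAt 1], [capAt 2], shift 1 s'.word, [cupAt 0], [capAt 4], shift 3 t'.word, [cupAt 2],
          [cupAt 1]].flatten := by
        simp [s', t', flipped, reflect, sum, shift_append, shift_shift, shift_cons, shift_nil]
    Red _ [[capAt 1], [capAt 2], shift 1 s'.word, [capAt 6], [cupAt 0], shift 3 t'.word, [cupAt 2],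
          [cupAt 1]].flatten := skip <| skip <| skip <| swap lower
    Red _ [[capAt 1], [capAt 2], shift 1 s'.word, [capAt 6], shift 5 t'.word, [cupAt 0], [cupAt 2],
          [cupAt 1]].flatten := skip <| skip <| skip <| skip <| swap lower_word
    Red _ [[capAt 1], [capAt 2], shift 1 s'.word, [capAt 6], shift 5 t'.word, [cupAt 4], [cupAt 0],
          [cupAt 1]].flatten := skip <| skip <| skip <| skip <| skip <| swap lower
    Red _ [[capAt 1], [capAt 2], shift 1 s'.word, [capAt 6], shift 5 t'.word, [cupAt 4], [cupAt 3],
          [cupAt 0]].flatten := skip <| skip <| skip <| skip <| skip <| skip <| swap lower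
    Red _ [[capAt 1], [capAt 2], [capAt 6], shift 1 s'.word, shift 5 t'.word, [cupAt 4], [cupAt 3],
          [cupAt 0]].flatten := skip <| skip <| swap s'.pass_right
    Red _ [[capAt 1], [capAt 4], [capAt 2], shift 1 s'.word, shift 5 t'.word, [cupAt 4], [cupAt 3],
          [cupAt 0]].flatten := skip <| swap lower
    Red _ [[capAt 2], [capAt 1], [capAt 2], shift 1 s'.word, shift 5 t'.word, [cupAt 4], [cupAt 3],
          [cupAt 0]].flatten := swap lower
    Red _ [[capAt 2], [capAt 1], [capAt 2], shift 5 t'.word, shift 1 s'.word, [cupAt 4], [cupAt 3],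
          [cupAt 0]].flatten := skip <| skip <| skip <| swap (pass_tangle s' t')
    Red _ [[capAt 2], [capAt 1], shift 3 t'.word, [capAt 2], shift 1 s'.word, [cupAt 4], [cupAt 3],
          [cupAt 0]].flatten := skip <| skip <| swap lower_word
    Red _ [[capAt 2], shift 1 t'.word, [capAt 1], [capAt 2], shift 1 s'.word, [cupAt 4], [cupAt 3],
          [cupAt 0]].flatten := skip <| swap lower_word
    Red _ [[capAt 2], shift 1 t'.word, [capAt 1], [capAt 2], [cupAt 4], shift 1 s'.word, [cupAt 3],
          [cupAt 0]].flatten := skip <| skip <| skip <| skip <| swap s'.pass_right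
    Red _ [[capAt 2], shift 1 t'.word, [capAt 1], [capAt 2], [cupAt 4], [cupAt 3], shift 1 s'.word,
          [cupAt 0]].flatten := skip <| skip <| skip <| skip <| skip <| swap s'.pass_right
    Red _ [[capAt 2], shift 1 t'.word, [capAt 1], [cupAt 2], [capAt 2], [cupAt 3], shift 1 s'.word,
          [cupAt 0]].flatten := skip <| skip <| skip <| swap lower
    Red _ [[capAt 2], shift 1 t'.word, [capAt 2], [cupAt 3], shift 1 s'.word,
          [cupAt 0]].flatten := skip <| skip <| cancel zigzagLeft
    Red _ [[capAt 2], shift 1 t'.word, shift 1 s'.word, [cupAt 0]].flatten :=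
      skip <| skip <| cancel zigzagLeft
    _ = (reflect (comp s t)).word := by
      simp [s', t', flipped, reflect, comp, shift_append, flip_append]

open Red in
theorem reflect_sum (s t : Tangle) :
    Isotopic (reflect (sum s t)) (comp (reflect s) (reflect t)) := by
  let s' := flipped s
  let t' := flipped t
  refine .of_red (w := [[capAt 2], [capAt 2], shift 1 s'.word, shift 3 t'.word, [cupAt 2],
    [cupAt 0]].flatten) ?_ ?_
  · calc (reflect (sum s t)).word
        = [[capAt 2], [capAt 2], shift 3 t'.word, shift 1 s'.word, [cupAt 2],
            [cupAt 0]].flatten := by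
          simp [s', t', flipped, reflect, sum, shift_append, shift_shift, shift_cons, shift_nil,
            flip_append, flip_shift, flip_cons, flip_nil, Event.flip]
      Red _ _ := skip <| skip <| swap (pass_tangle' s' t')
  · calc (comp (reflect s) (reflect t)).word
        = [[capAt 2], shift 1 s'.word, [cupAt 0], [capAt 2], shift 1 t'.word,
            [cupAt 0]].flatten := by simp [s', t', flipped, reflect, comp]
      Red _ [[capAt 2], shift 1 s'.word, [capAt 4], [cupAt 0], shift 1 t'.word,
            [cupAt 0]].flatten := skip <| skip <| swap lower
      Red _ [[capAt 2], shift 1 s'.word, [capAt 4], shift 3 t'.word, [cupAt 0],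
            [cupAt 0]].flatten := skip <| skip <| skip <| swap lower_word
      Red _ [[capAt 2], [capAt 4], shift 1 s'.word, shift 3 t'.word, [cupAt 0],
            [cupAt 0]].flatten := skip <| swap s'.pass_right
      Red _ [[capAt 2], [capAt 2], shift 1 s'.word, shift 3 t'.word, [cupAt 0],
            [cupAt 0]].flatten := swap lower
      Red _ [[capAt 2], [capAt 2], shift 1 s'.word, shift 3 t'.word, [cupAt 2],
            [cupAt 0]].flatten := skip <| skip <| skip <| skip <| swap lower

/-- The tangle `t + 1` or `t - 1`, with the crossing moved to the top. -/
def twist (s : Bool) (t : Tangle) : Tangle :=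
  ⟨[capAt 2, crossingAt (!s) 1] ++ t.word ++ [cupAt 1],
    Fits.append (m := 4) (Fits.append (m := 4) (by simp [Fits, Event.inputs, Event.outputs])
      (t.fits.right 2)) (by simp [Fits, Event.inputs, Event.outputs])⟩

theorem twist_word (s : Bool) (t : Tangle) :
    (twist s t).word = [[capAt 2], [crossingAt (!s) 1], shift 0 t.word, [cupAt 1]].flatten := by
  simp [twist, shift_zero]

open Red in
-- The crossing rises past `t` and slides to the other leg of the maximum, which changes its sign.
-- At the top it can interact with crossings above `t`.
theorem sum_unit (s : Bool) (t : Tangle) : Isotopic (sum t (unit s)) (twist s t) := by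
  refine .of_red (w := [[capAt 2], [crossingAt (!s) 1], shift 0 t.word, [cupAt 1]].flatten) ?_ ?_
  · calc (sum t (unit s)).word
        = [[capAt 1], shift 0 t.word, [crossingAt s 2], [cupAt 1]].flatten := by
          simp [sum, unit, shift_zero, shift_cons, shift_nil]
      Red _ [[capAt 1], [crossingAt s 2], shift 0 t.word, [cupAt 1]].flatten :=
        skip <| swap t.pass_right
      Red _ [[capAt 2], [crossingAt (!s) 1], shift 0 t.word, [cupAt 1]].flatten := swap slideCap'
  · rw [twist_word]; exact .refl _

theorem unit_comp_unit (s : Bool) : Isotopic (comp (unit s) (unit (!s))) infty :=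
  .of_red (w := []) (.move (.reidemeisterTwo s 0)) (.refl _)

theorem zero_comp_unit (s : Bool) : Isotopic (comp zero (unit s)) zero :=
  .of_red (w := zero.word)
    (((Red.move (.reidemeisterOneCap s 0)).under [cupAt 0])) (.refl _)

theorem unit_comp_zero (s : Bool) : Isotopic (comp (unit s) zero) zero :=
  .of_red (w := zero.word)
    (((Red.move (.reidemeisterOneCup s 0)).before [capAt 0])) (.refl _)

open Red in
-- With all crossings moved above `t`, both sides show three successive crossings of sign `s`, and
-- they differ by the third Reidemeister move. The sign `!s` on the right is what produces the sign
-- `s` after the slide.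
theorem braid_relation (s : Bool) (t : Tangle) :
    Isotopic (comp (unit s) (twist (!s) (comp (unit s) t)))
      (twist (!s) (comp (unit s) (twist (!s) t))) := by
  refine .of_red (w := [[capAt 2], [crossingAt s 1], [crossingAt s 0], [crossingAt s 1],
    shift 0 t.word, [cupAt 1]].flatten) ?_ ?_
  · calc (comp (unit s) (twist (!s) (comp (unit s) t))).word
        = [[crossingAt s 0], [capAt 2], [crossingAt s 1], [crossingAt s 0],
            shift 0 t.word, [cupAt 1]].flatten := by
          simp [comp, unit, twist, shift_zero]
      Red _ [[capAt 2], [crossingAt s 0], [crossingAt s 1], [crossingAt s 0],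
            shift 0 t.word, [cupAt 1]].flatten := swap lower
      Red _ [[capAt 2], [crossingAt s 1], [crossingAt s 0], [crossingAt s 1],
            shift 0 t.word, [cupAt 1]].flatten :=
        skip <| three <| .move (.reidemeisterThree s s s 0 (.inl rfl))
  · calc (twist (!s) (comp (unit s) (twist (!s) t))).word
        = [[capAt 2], [crossingAt s 1], [crossingAt s 0], [capAt 2], [crossingAt s 1],
            shift 0 t.word, [cupAt 1], [cupAt 1]].flatten := by
          simp [comp, unit, twist, shift_zero]
      Red _ [[capAt 2], [crossingAt s 1], [crossingAt s 0], [capAt 2], [crossingAt s 1],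
            shift 0 t.word, [cupAt 3], [cupAt 1]].flatten :=
        skip <| skip <| skip <| skip <| skip <| skip <| swap lower
      Red _ [[capAt 2], [crossingAt s 1], [crossingAt s 0], [capAt 2], [crossingAt s 1],
            [cupAt 3], shift 0 t.word, [cupAt 1]].flatten :=
        skip <| skip <| skip <| skip <| skip <| swap t.pass_right
      Red _ [[capAt 2], [crossingAt s 1], [crossingAt s 0], [capAt 2], [cupAt 3],
            [crossingAt s 1], shift 0 t.word, [cupAt 1]].flatten :=
        skip <| skip <| skip <| skip <| swap lower
      Red _ _ := skip <| skip <| skip <| cancel zigzagLeft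

theorem flipped_congr {s t : Tangle} (h : Isotopic s t) : Isotopic (flipped s) (flipped t) :=
  h.flip

theorem flipped_flipped (t : Tangle) : flipped (flipped t) = t := by
  obtain ⟨w, h⟩ := t
  have hf : (fun a : Slice => (⟨a.event.flip.flip, a.pos⟩ : Slice)) = id := by
    funext ⟨e, i⟩
    cases e <;> simp [Event.flip]
  simp [flipped, flip, Function.comp_def, hf]

theorem flipped_comp (s t : Tangle) : flipped (comp s t) = comp (flipped t) (flipped s) := by
  simp [flipped, comp, flip_append]

open Red in
theorem flipped_sum_unit (s : Bool) (t : Tangle) :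
    Isotopic (flipped (sum t (unit s))) (sum (flipped t) (unit (!s))) := by
  let t' := flipped t
  refine .of_red (w := (sum (flipped t) (unit (!s))).word) ?_ (.refl _)
  calc (flipped (sum t (unit s))).word
      = [[capAt 1], [crossingAt (!s) 2], shift 0 t'.word, [cupAt 1]].flatten := by
        simp [t', flipped, sum, unit, shift_zero, shift_cons, shift_nil,
          flip_append, flip_cons, flip_nil, Event.flip]
    Red _ [[capAt 1], shift 0 t'.word, [crossingAt (!s) 2], [cupAt 1]].flatten :=
        skip <| swap t'.pass_right'
    _ = _ := by simp [t', sum, unit, shift_zero, shift_cons, shift_nil]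

end Tangle
/-! ### Actions of the braid group on four strands -/

section BraidAction

variable {G α : Type*} [Group G] [MulAction G α] {x y z a b : G} {v : α}

theorem inv_mul_mul_eq_of_braid (h : x * y * x = y * x * y) : x⁻¹ * y * x = y * x * y⁻¹ := by
  rw [mul_assoc, inv_mul_eq_iff_eq_mul, ← mul_assoc, eq_mul_inv_iff_mul_eq, ← mul_assoc, h]

theorem inv_mul_inv_mul_eq_of_braid (h : x * y * x = y * x * y) :
    x⁻¹ * y⁻¹ * x = y * x⁻¹ * y⁻¹ := by
  simpa [mul_assoc] using congrArg (·⁻¹) (inv_mul_mul_eq_of_braid h)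

/-- The element `b` splits as a conjugate of `y` by `x⁻¹` times a conjugate of `y⁻¹` by `z⁻¹`.
Conjugation by `x` cancels the first of these. This formula and `inv_mul_mul_eq_of_braid_four` keep
the needed conjugates of `a` and `b` inside the subgroup generated by `a` and `b`. -/
theorem mul_mul_inv_eq_of_braid (hxy : x * y * x = y * x * y)
    (hzy : z * y * z = y * z * y) (ha : a = x * z⁻¹) (hb : b = y * a * y⁻¹) :
    x * b * x⁻¹ = b * a⁻¹ := by
  have h1 := inv_mul_mul_eq_of_braid hxy
  have h2 := inv_mul_inv_mul_eq_of_braid hzy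
  have hb' : b = x⁻¹ * y * x * (z⁻¹ * y⁻¹ * z) := by rw [h1, h2, hb, ha]; group
  have ha' : a⁻¹ = z * x⁻¹ := by rw [ha]; group
  calc x * b * x⁻¹ = y * x * (z⁻¹ * y⁻¹ * z) * x⁻¹ := by rw [hb']; group
    _ = y * (x * z⁻¹) * y⁻¹ * (z * x⁻¹) := by group
    _ = _ := by rw [← ha', ← ha, ← hb]

theorem inv_mul_mul_eq_of_braid_four (hxz : x * z = z * x) (hxy : x * y * x = y * x * y)
    (hzy : z * y * z = y * z * y) (ha : a = x * z⁻¹) (hb : b = y * a * y⁻¹) :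
    y⁻¹ * a * y = a * b⁻¹ * a := by
  have e1 := inv_mul_mul_eq_of_braid hxy.symm
  have e3 := inv_mul_inv_mul_eq_of_braid hzy.symm
  have hc := mul_mul_inv_eq_of_braid hxy hzy ha hb
  have hz : z⁻¹ = x⁻¹ * a := by rw [ha]; group
  have hx : x⁻¹ * z = a⁻¹ := by
    rw [ha, mul_inv_rev, inv_inv, inv_mul_eq_iff_eq_mul, ← mul_assoc, hxz]; group
  calc y⁻¹ * a * y = (y⁻¹ * x * y) * (y⁻¹ * z⁻¹ * y) := by rw [ha]; group
    _ = x * (y * (x⁻¹ * z) * y⁻¹) * z⁻¹ := by rw [e1, e3]; group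
    _ = x * b⁻¹ * (x⁻¹ * a) := by rw [hx, hz, hb]; group
    _ = (x * b * x⁻¹)⁻¹ * a := by group
    _ = _ := by rw [hc]; group

/-- The points that are fixed by `x * z⁻¹` and by its conjugate by `y`. If `x`, `y`, `z` satisfy the
relations of the braid group on four strands, then these two elements generate the kernel of the
homomorphism to the braid group on three strands that identifies `x` and `z`. -/
def IsFlypeInvariant (x y z : G) (v : α) : Prop :=
  (x * z⁻¹) • v = v ∧ (y * (x * z⁻¹) * y⁻¹) • v = v

namespace IsFlypeInvariant

theorem smul_eq (hxz : x * z = z * x) (h : IsFlypeInvariant x y z v) : x • v = z • v := by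
  have h1 : x = z * (x * z⁻¹) := by rw [← mul_assoc, ← hxz]; group
  rw [h1, mul_smul, h.1]

/-- An element fixes `y • v` as soon as its conjugate by `y⁻¹` fixes `v`. The identities `e1` to
`e4` write the relevant conjugates as words in `a` and `b`. -/
theorem smul_y (hxz : x * z = z * x) (hxy : x * y * x = y * x * y)
    (hzy : z * y * z = y * z * y) (h : IsFlypeInvariant x y z v) :
    IsFlypeInvariant x y z (y • v) ∧ IsFlypeInvariant x y z (y⁻¹ • v) := by
  obtain ⟨ha, hb⟩ := h
  unfold IsFlypeInvariant
  generalize ha' : x * z⁻¹ = a at *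
  generalize hb' : y * a * y⁻¹ = b at *
  have ha2 : a⁻¹ • v = v := inv_smul_eq_iff.2 ha.symm
  have hb2 : b⁻¹ • v = v := inv_smul_eq_iff.2 hb.symm
  have hd := inv_mul_mul_eq_of_braid_four hxz hxy hzy ha'.symm hb'.symm
  have e1 : a * y = y * (a * b⁻¹ * a) := by rw [← hd]; group
  have e2 : b * y = y * a := by rw [← hb']; group
  have e3 : a * y⁻¹ = y⁻¹ * b := by rw [← hb']; group
  have e4 : b * y⁻¹ = y⁻¹ * (b * a⁻¹ * b) := by
    have h4 : a = b * (y * b⁻¹ * y⁻¹) * b := by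
      calc a = y * (y⁻¹ * a * y) * y⁻¹ := by group
        _ = (y * a * y⁻¹) * (y * b⁻¹ * y⁻¹) * (y * a * y⁻¹) := by rw [hd]; group
        _ = _ := by rw [hb']
    rw [show b * a⁻¹ * b = y * b * y⁻¹ by rw [h4]; group]
    group
  refine ⟨⟨?_, ?_⟩, ?_, ?_⟩
  · rw [smul_smul, e1, mul_smul, mul_smul, mul_smul, ha, hb2, ha]
  · rw [smul_smul, e2, mul_smul, ha]
  · rw [smul_smul, e3, mul_smul, hb]
  · rw [smul_smul, e4, mul_smul, mul_smul, mul_smul, hb, ha2, hb]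

theorem smul_z (hxz : x * z = z * x) (hxy : x * y * x = y * x * y)
    (hzy : z * y * z = y * z * y) (h : IsFlypeInvariant x y z v) :
    IsFlypeInvariant x y z (z • v) ∧ IsFlypeInvariant x y z (z⁻¹ • v) := by
  obtain ⟨ha, hb⟩ := h
  unfold IsFlypeInvariant
  have e1 : x * z⁻¹ * z = z * (x * z⁻¹) := by rw [← mul_assoc, ← hxz]; group
  generalize ha' : x * z⁻¹ = a at *
  generalize hb' : y * a * y⁻¹ = b at *
  have ha2 : a⁻¹ • v = v := inv_smul_eq_iff.2 ha.symm
  have hc := mul_mul_inv_eq_of_braid hxy hzy ha'.symm hb'.symm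
  have hx : x = a * z := by rw [← ha']; group
  have hd : z * b * z⁻¹ = a⁻¹ * b := by
    calc z * b * z⁻¹ = a⁻¹ * (a * z * b * (a * z)⁻¹) * a := by group
      _ = _ := by rw [← hx, hc]; group
  have e2 : b * z = z * (a * b) := by
    calc b * z = a * (a⁻¹ * b) * z := by group
      _ = a * z * b := by rw [← hd]; group
      _ = _ := by rw [e1]; group
  have e3 : a * z⁻¹ = z⁻¹ * a := by
    rw [eq_inv_mul_iff_mul_eq, ← mul_assoc, ← e1]; group
  have e4 : b * z⁻¹ = z⁻¹ * (a⁻¹ * b) := by rw [← hd]; group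
  refine ⟨⟨?_, ?_⟩, ?_, ?_⟩
  · rw [smul_smul, e1, mul_smul, ha]
  · rw [smul_smul, e2, mul_smul, mul_smul, hb, ha]
  · rw [smul_smul, e3, mul_smul, ha]
  · rw [smul_smul, e4, mul_smul, mul_smul, hb, ha2]

end IsFlypeInvariant

end BraidAction

/-! ### Isotopy classes of tangles -/

instance tangleSetoid : Setoid Tangle where
  r := Isotopic
  iseqv := ⟨.refl, .symm _ _, .trans⟩

/-- Isotopy classes of tangles. -/
def TangleClass : Type := Quotient tangleSetoid

namespace TangleClass

open Tangle

/-- The isotopy class of a tangle. -/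
def mk (t : Tangle) : TangleClass := Quotient.mk _ t

theorem mk_eq {s t : Tangle} : mk s = mk t ↔ Isotopic s t := Quotient.eq (r := tangleSetoid)

theorem mk_surjective (v : TangleClass) : ∃ t, mk t = v := Quotient.exists_rep v

instance : Zero TangleClass := ⟨mk zero⟩

instance : Add TangleClass := ⟨Quotient.map₂ sum fun _ _ h _ _ h' => sum_congr h h'⟩

/-- Addition is the tangle sum. -/
instance : AddMonoid TangleClass where
  add_assoc u v w := by
    obtain ⟨u, rfl⟩ := u.mk_surjective
    obtain ⟨v, rfl⟩ := v.mk_surjective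
    obtain ⟨w, rfl⟩ := w.mk_surjective
    exact mk_eq.2 (sum_assoc u v w)
  zero_add v := by
    obtain ⟨v, rfl⟩ := v.mk_surjective
    exact mk_eq.2 (zero_sum v)
  add_zero v := by
    obtain ⟨v, rfl⟩ := v.mk_surjective
    exact mk_eq.2 (sum_zero v)
  nsmul := nsmulRec

/-- Multiplication is the vertical composition of tangles; its neutral element is the class of the
tangle `∞`. -/
instance : Monoid TangleClass where
  mul := Quotient.map₂ comp fun _ _ h _ _ h' => comp_congr h h'
  one := mk infty
  mul_assoc u v w := by
    obtain ⟨u, rfl⟩ := u.mk_surjective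
    obtain ⟨v, rfl⟩ := v.mk_surjective
    obtain ⟨w, rfl⟩ := w.mk_surjective
    refine congrArg mk (show comp (comp u v) w = comp u (comp v w) from ?_)
    simp [comp]
  one_mul v := by
    obtain ⟨v, rfl⟩ := v.mk_surjective
    rfl
  mul_one v := by
    obtain ⟨v, rfl⟩ := v.mk_surjective
    refine congrArg mk (show comp v infty = v from ?_)
    simp [comp, infty]

theorem mk_sum (s t : Tangle) : mk (sum s t) = mk s + mk t := rfl

theorem mk_zero : mk zero = 0 := rfl

/-- The reflection of tangles in the NW-SE axis. -/
def refl : TangleClass → TangleClass := Quotient.map reflect fun _ _ => reflect_congr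

theorem mk_reflect (t : Tangle) : mk (reflect t) = refl (mk t) := rfl

/-- The reflection of tangles in the horizontal axis. -/
def hrefl : TangleClass → TangleClass := Quotient.map flipped fun _ _ => flipped_congr

/-- The classes of the tangles `1` and `-1`. -/
def unit (s : Bool) : TangleClass := mk (Tangle.unit s)

variable (u v w : TangleClass) (s : Bool)

theorem refl_mul : refl (v * w) = refl v + refl w := by
  obtain ⟨v, rfl⟩ := v.mk_surjective
  obtain ⟨w, rfl⟩ := w.mk_surjective
  exact mk_eq.2 (reflect_comp v w)

theorem refl_add : refl (v + w) = refl v * refl w := by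
  obtain ⟨v, rfl⟩ := v.mk_surjective
  obtain ⟨w, rfl⟩ := w.mk_surjective
  exact mk_eq.2 (reflect_sum v w)

theorem refl_zero : refl 0 = 1 := mk_eq.2 reflect_zero

theorem refl_one : refl 1 = 0 := mk_eq.2 reflect_infty

theorem refl_unit : refl (unit s) = unit s := mk_eq.2 (reflect_unit s)

theorem unit_mul_unit : unit s * unit (!s) = 1 := mk_eq.2 (unit_comp_unit s)

/-- Reflection exchanges sum and vertical composition, and `0` with `∞`, while it fixes a crossing.
The second Reidemeister move thus need only be drawn for vertical composition. -/
theorem unit_add_unit : unit s + unit (!s) = 0 := by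
  simpa only [refl_mul, refl_unit, refl_one] using congrArg refl (unit_mul_unit s)

theorem zero_mul_unit : 0 * unit s = 0 := mk_eq.2 (zero_comp_unit s)

theorem unit_mul_zero : unit s * 0 = 0 := mk_eq.2 (unit_comp_zero s)

theorem one_add_unit : 1 + unit s = 1 := by
  simpa only [refl_mul, refl_unit, refl_zero] using congrArg refl (zero_mul_unit s)

theorem hrefl_hrefl : hrefl (hrefl v) = v := by
  obtain ⟨v, rfl⟩ := v.mk_surjective
  exact congrArg mk (flipped_flipped v)

theorem hrefl_mul : hrefl (v * w) = hrefl w * hrefl v := by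
  obtain ⟨v, rfl⟩ := v.mk_surjective
  obtain ⟨w, rfl⟩ := w.mk_surjective
  exact congrArg mk (flipped_comp v w)

theorem hrefl_unit : hrefl (unit s) = unit (!s) := rfl

theorem hrefl_add_unit : hrefl (v + unit s) = hrefl v + unit (!s) := by
  obtain ⟨v, rfl⟩ := v.mk_surjective
  exact mk_eq.2 (flipped_sum_unit s v)

theorem braid_top :
    unit s * (unit s * v + unit (!s)) = unit s * (v + unit (!s)) + unit (!s) := by
  obtain ⟨v, rfl⟩ := v.mk_surjective
  have h (t : Tangle) : mk t + unit (!s) = mk (twist (!s) t) := mk_eq.2 (sum_unit _ t)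
  have h' (t : Tangle) : unit s * mk t = mk (comp (Tangle.unit s) t) := rfl
  rw [h', h, h', h, h', h]
  exact mk_eq.2 (braid_relation s v)

theorem braid_bottom :
    (v * unit s + unit (!s)) * unit s = (v + unit (!s)) * unit s + unit (!s) := by
  have h := congrArg hrefl (braid_top (hrefl v) (!s))
  simpa only [hrefl_mul, hrefl_add_unit, hrefl_unit, hrefl_hrefl, Bool.not_not] using h

/-! ### The braid group action on tangle classes -/

/-- A crossing is added at the top. -/
def top : Equiv.Perm TangleClass where
  toFun v := unit true * v
  invFun v := unit false * v
  left_inv v := by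
    show unit false * (unit true * v) = v
    rw [← mul_assoc]; exact (congrArg (· * v) (unit_mul_unit false)).trans (one_mul v)
  right_inv v := by
    show unit true * (unit false * v) = v
    rw [← mul_assoc]; exact (congrArg (· * v) (unit_mul_unit true)).trans (one_mul v)

/-- A crossing is added at the bottom. -/
def bottom : Equiv.Perm TangleClass where
  toFun v := v * unit true
  invFun v := v * unit false
  left_inv v := by
    show v * unit true * unit false = v
    rw [mul_assoc]; exact (congrArg (v * ·) (unit_mul_unit true)).trans (mul_one v)
  right_inv v := by
    show v * unit false * unit true = v
    rw [mul_assoc]; exact (congrArg (v * ·) (unit_mul_unit false)).trans (mul_one v)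

/-- A negative crossing is added on the right. -/
def right : Equiv.Perm TangleClass where
  toFun v := v + unit false
  invFun v := v + unit true
  left_inv v := by
    show v + unit false + unit true = v
    rw [add_assoc]; exact (congrArg (v + ·) (unit_add_unit false)).trans (add_zero v)
  right_inv v := by
    show v + unit true + unit false = v
    rw [add_assoc]; exact (congrArg (v + ·) (unit_add_unit true)).trans (add_zero v)

theorem top_mul_bottom : top * bottom = bottom * top :=
  Equiv.ext fun v => (mul_assoc (unit true) v (unit true)).symm

/-- The opposite signs in `top` and `right` matter here: a crossing from the right changes sign on
its way over the maximum. -/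
theorem top_braid : top * right * top = right * top * right :=
  Equiv.ext fun v => braid_top v true

theorem bottom_braid : bottom * right * bottom = right * bottom * right :=
  Equiv.ext fun v => braid_bottom v true

/-! ### Rational tangles -/

/-- The classes that arise from the tangles `0` and `∞` by adding crossings at the bottom and on the
right. -/
inductive IsRational : TangleClass → Prop
  | zero : IsRational 0
  | one : IsRational 1
  | mul {v : TangleClass} (h : IsRational v) (s : Bool) : IsRational (v * unit s)
  | add {v : TangleClass} (h : IsRational v) (s : Bool) : IsRational (v + unit s)

/-- For `0` and `∞` the crossings involved cancel or untwist by the first two Reidemeister moves.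
Adding a crossing at the bottom or on the right applies a generator or its inverse, which preserves
invariance. -/
theorem IsRational.isFlypeInvariant {v : TangleClass} (h : IsRational v) :
    IsFlypeInvariant top right bottom v := by
  have e := unit_mul_unit true
  have e' := unit_add_unit true
  rw [Bool.not_true] at e e'
  induction h with
  | zero =>
    constructor
    · show unit true * (0 * unit false) = 0
      rw [zero_mul_unit, unit_mul_zero]
    · show unit true * ((0 + unit true) * unit false) + unit false = 0
      rw [zero_add, e, mul_one, e']
  | one =>
    constructor
    · show unit true * (1 * unit false) = 1
      rw [one_mul, e]
    · show unit true * ((1 + unit true) * unit false) + unit false = 1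
      rw [one_add_unit, one_mul, e, one_add_unit]
  | mul _ s ih =>
    have := ih.smul_z top_mul_bottom top_braid bottom_braid
    cases s
    · exact this.2
    · exact this.1
  | add _ s ih =>
    have := ih.smul_y top_mul_bottom top_braid bottom_braid
    cases s
    -- Since `right` adds the negative crossing, `false` is the generator itself here, whereas at
    -- the bottom it is the inverse.
    · exact this.1
    · exact this.2

namespace IsRational

variable {v}

theorem unit_mul_eq (h : IsRational v) (s : Bool) : unit s * v = v * unit s := by
  have h1 : unit true * v = v * unit true := h.isFlypeInvariant.smul_eq top_mul_bottom
  cases s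
  · have e := unit_mul_unit true
    have e' := unit_mul_unit false
    rw [Bool.not_true] at e
    rw [Bool.not_false] at e'
    calc unit false * v = unit false * (v * unit true) * unit false := by
          rw [mul_assoc, mul_assoc, e, mul_one]
      _ = _ := by rw [← h1, ← mul_assoc, e', one_mul]
  · exact h1

protected theorem refl (h : IsRational v) : IsRational (refl v) := by
  induction h with
  | zero => rw [refl_zero]; exact one
  | one => rw [refl_one]; exact zero
  | mul _ s ih => rw [refl_mul, refl_unit]; exact ih.add s
  | add _ s ih => rw [refl_add, refl_unit]; exact ih.mul s

/-- For rational classes no isotopy has to be drawn: each added crossing moves from the bottom to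
the right and back. -/
theorem refl_refl (h : IsRational v) : TangleClass.refl (TangleClass.refl v) = v := by
  induction h with
  | zero => rw [refl_zero, refl_one]
  | one => rw [refl_one, refl_zero]
  | mul _ s ih => rw [refl_mul, refl_unit, refl_add, refl_unit, ih]
  | add _ s ih => rw [refl_add, refl_unit, refl_mul, refl_unit, ih]

/-- This is the flype from top to bottom for the reflected class, reflected back. -/
theorem unit_add_eq (h : IsRational v) (s : Bool) : unit s + v = v + unit s := by
  have h1 := congrArg TangleClass.refl (h.refl.unit_mul_eq s)
  rwa [refl_mul, refl_mul, refl_unit, h.refl_refl] at h1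

end IsRational

/-! ### Integral tangles -/

/-- The tangle `1` as an invertible element with respect to the sum. -/
def addUnit : AddUnits TangleClass :=
  ⟨unit true, unit false, unit_add_unit true, unit_add_unit false⟩

/-- The tangle `1` as an invertible element with respect to the vertical composition. -/
def mulUnit : TangleClassˣ :=
  ⟨unit true, unit false, unit_mul_unit true, unit_mul_unit false⟩

/-- The class of the integral tangle `a`. -/
def int (a : ℤ) : TangleClass := (a • addUnit : AddUnits TangleClass)

/-- The class of a vertical row of crossings, the reflection of an integral tangle. -/
def vint (a : ℤ) : TangleClass := (mulUnit ^ a : TangleClassˣ)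

theorem int_zero : int 0 = 0 := by simp [int]

theorem vint_zero : vint 0 = 1 := by simp [vint]

theorem int_add (a b : ℤ) : int (a + b) = int a + int b := by simp [int, add_zsmul]

theorem vint_add (a b : ℤ) : vint (a + b) = vint a * vint b := by simp [vint, zpow_add]

theorem int_one : int 1 = unit true := by simp [int, addUnit]

theorem vint_one : vint 1 = unit true := by simp [vint, mulUnit]

theorem int_neg_one : int (-1) = unit false := by
  rw [int, neg_zsmul, one_zsmul]; rfl

theorem vint_neg_one : vint (-1) = unit false := by
  simp only [vint, zpow_neg, zpow_one]; rfl

theorem refl_int (a : ℤ) : refl (int a) = vint a := by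
  induction a using Int.induction_on with
  | zero => rw [int_zero, vint_zero, refl_zero]
  | succ n ih => rw [int_add, vint_add, refl_add, ih, int_one, vint_one, refl_unit]
  | pred n ih =>
    rw [sub_eq_add_neg, int_add, vint_add, refl_add, ih, int_neg_one, vint_neg_one, refl_unit]

theorem IsRational.add_int {v : TangleClass} (h : IsRational v) (a : ℤ) :
    IsRational (v + int a) := by
  induction a using Int.induction_on with
  | zero => rwa [int_zero, add_zero]
  | succ n ih => rw [int_add, ← add_assoc, int_one]; exact ih.add _
  | pred n ih => rw [sub_eq_add_neg, int_add, ← add_assoc, int_neg_one]; exact ih.add _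

theorem IsRational.int_add_eq {v : TangleClass} (h : IsRational v) (a : ℤ) :
    int a + v = v + int a :=
  (AddCommute.addUnits_zsmul_left (u := addUnit) (h.unit_add_eq true) a)

theorem mk_copies (n : ℕ) : mk (copies s n) = n • unit s := by
  induction n with
  | zero => rw [zero_smul]; rfl
  | succ n ih =>
    cases n with
    | zero => rw [zero_add, one_smul]; rfl
    | succ n => rw [succ_nsmul, ← ih]; rfl

theorem mk_integral (a : ℤ) : mk (integral a) = int a := by
  rw [integral, mk_copies]
  obtain ⟨n, rfl | rfl⟩ := a.eq_nat_or_neg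
  · simp [int, addUnit]
  -- Zero is set apart because `integral` counts it as nonnegative.
  · rcases n.eq_zero_or_pos with rfl | h
    · simp [int]
    · have e : ((-addUnit : AddUnits TangleClass) : TangleClass) = unit false := rfl
      have e' : decide (0 ≤ -(n : ℤ)) = false := by simp; omega
      rw [int, neg_zsmul, ← zsmul_neg, natCast_zsmul, AddUnits.val_nsmul_eq_nsmul_val, e, e',
        Int.natAbs_neg, Int.natAbs_natCast]

/-! ### Continued fractions and rotation -/

/-- The class of the rational tangle with the given continued fraction. -/
def contFrac (l : List ℤ) : TangleClass := mk (ofContFrac l)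

theorem contFrac_nil : contFrac [] = 1 := rfl

/-- The value `∞` of the empty list reflects to `0`, so the recursion also covers lists of length
one. -/
theorem contFrac_cons (a : ℤ) (l : List ℤ) : contFrac (a :: l) = refl (contFrac l) + int a := by
  cases l with
  | nil => rw [contFrac_nil, refl_one, zero_add]; exact mk_integral a
  | cons b l => rw [← mk_integral]; rfl

theorem isRational_contFrac (l : List ℤ) : IsRational (contFrac l) := by
  induction l with
  | nil => exact .one
  | cons a l ih => rw [contFrac_cons]; exact ih.refl.add_int a

/-- Rotation of a rational tangle by a right angle, as a sequence of added crossings. -/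
def rot : TangleClass := (v + unit false) * unit true + unit false

/-- As a permutation, `rot` is `right * bottom * right`. By the braid relation, conjugation by it
exchanges `right` and `bottom`; the sign changes because these add crossings of opposite signs. -/
theorem rot_mul_unit : rot (v * unit s) = rot v + unit (!s) := by
  have h (w : TangleClass) : rot (w * unit true) = rot w + unit false := by
    have := congrArg (· + unit false) (braid_bottom w true)
    simpa [rot] using this
  cases s
  · have e := unit_mul_unit false
    have e' := unit_add_unit false
    have h1 := h (v * unit false)
    rw [Bool.not_false] at *
    rw [mul_assoc, e, mul_one] at h1
    rw [h1, add_assoc, e', add_zero]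
  · exact h v

theorem rot_add_unit : rot (v + unit s) = rot v * unit (!s) := by
  have h (w : TangleClass) : rot (w + unit false) = rot w * unit true :=
    (braid_bottom (w + unit false) true).symm
  cases s
  · exact h v
  · have e := unit_mul_unit true
    have e' := unit_add_unit true
    have h1 := h (v + unit true)
    rw [Bool.not_true] at *
    rw [add_assoc, e', add_zero] at h1
    rw [h1, mul_assoc, e, mul_one]

theorem rot_mul_vint (a : ℤ) : rot (v * vint a) = rot v + int (-a) := by
  induction a using Int.induction_on with
  | zero => simp [int_zero, vint_zero]
  | succ n ih =>
    rw [vint_add, vint_one, ← mul_assoc, rot_mul_unit, ih, neg_add, int_add, int_neg_one,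
      add_assoc, Bool.not_true]
  | pred n ih =>
    rw [sub_eq_add_neg, vint_add, vint_neg_one, ← mul_assoc, rot_mul_unit, ih, neg_add, int_add,
      neg_neg 1, int_one, add_assoc, Bool.not_false]

theorem rot_add_int (a : ℤ) : rot (v + int a) = rot v * vint (-a) := by
  induction a using Int.induction_on with
  | zero => simp [int_zero, vint_zero]
  | succ n ih =>
    rw [int_add, int_one, ← add_assoc, rot_add_unit, ih, neg_add, vint_add, vint_neg_one,
      mul_assoc, Bool.not_true]
  | pred n ih =>
    rw [sub_eq_add_neg, int_add, int_neg_one, ← add_assoc, rot_add_unit, ih, neg_add, vint_add,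
      neg_neg 1, vint_one, mul_assoc, Bool.not_false]

theorem rot_one : rot 1 = 0 := by
  rw [rot, one_add_unit, one_mul]; exact unit_add_unit true

theorem rot_zero : rot 0 = 1 := by
  have h : unit false * unit true = 1 := unit_mul_unit false
  rw [rot, zero_add, h, one_add_unit]

/-- A further quotient involves a reflection, so each of the two claims for the longer list rests on
the other one for the shorter list. The induction carries both. -/
theorem contFrac_neg (l : List ℤ) :
    refl (contFrac (l.map (- ·))) = rot (contFrac l) ∧
      contFrac (l.map (- ·)) = rot (refl (contFrac l)) := by
  induction l with
  | nil => simp only [List.map_nil, contFrac_nil, refl_one, rot_one, rot_zero, and_self]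
  | cons a l ih =>
    simp only [List.map_cons, contFrac_cons, refl_add, refl_int]
    rw [(isRational_contFrac l).refl_refl, (isRational_contFrac _).refl_refl, rot_add_int,
      rot_mul_vint, ih.1, ih.2]
    exact ⟨rfl, rfl⟩

end TangleClass
namespace TangleClass

/-! ### Fractions of rational tangles -/

/-- The class of the rational tangle of the fraction `p/q`. -/
def frac (p q : ℕ) : TangleClass := contFrac ((quotients p q).map fun a : ℕ => (a : ℤ))

/-- The class of the rational tangle of the fraction `-p/q`. -/
def negFrac (p q : ℕ) : TangleClass := contFrac ((quotients p q).map fun a : ℕ => -(a : ℤ))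

theorem isRational_frac (p q : ℕ) : IsRational (frac p q) := isRational_contFrac _

theorem isRational_negFrac (p q : ℕ) : IsRational (negFrac p q) := isRational_contFrac _

theorem quotients_zero (p : ℕ) : quotients p 0 = [] := by rw [quotients]

theorem quotients_of_pos (p : ℕ) {q : ℕ} (hq : 0 < q) :
    quotients p q = p / q :: quotients q (p % q) := by
  obtain ⟨q, rfl⟩ := Nat.exists_eq_add_of_lt hq
  rw [zero_add, quotients]

theorem frac_zero (p : ℕ) : frac p 0 = 1 := by
  rw [frac, quotients_zero]; rfl

theorem negFrac_zero (p : ℕ) : negFrac p 0 = 1 := by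
  rw [negFrac, quotients_zero]; rfl

theorem frac_of_pos (p : ℕ) {q : ℕ} (hq : 0 < q) :
    frac p q = refl (frac q (p % q)) + int (p / q : ℕ) := by
  rw [frac, quotients_of_pos p hq, List.map_cons, contFrac_cons]; rfl

theorem negFrac_of_pos (p : ℕ) {q : ℕ} (hq : 0 < q) :
    negFrac p q = refl (negFrac q (p % q)) + int (-(p / q : ℕ)) := by
  rw [negFrac, quotients_of_pos p hq, List.map_cons, contFrac_cons]; rfl

theorem refl_negFrac_eq_rot (p q : ℕ) : refl (negFrac p q) = rot (frac p q) := by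
  have := (contFrac_neg ((quotients p q).map fun a : ℕ => (a : ℤ))).1
  rwa [List.map_map] at this

theorem frac_add_self (p : ℕ) {q : ℕ} (hq : 0 < q) : frac (p + q) q = frac p q + unit true := by
  rw [frac_of_pos _ hq, frac_of_pos _ hq, Nat.add_mod_right, Nat.add_div_right _ hq, add_assoc,
    ← int_one, ← int_add]
  rfl

/-- For `p < q` the Euclidean algorithm starts with the quotient `0` and goes on with the pair `q`,
`p`. -/
theorem frac_swap_of_lt {p q : ℕ} (h : p < q) : refl (frac p q) = frac q p := by
  rw [frac_of_pos p (by omega), Nat.mod_eq_of_lt h, Nat.div_eq_of_lt h, Nat.cast_zero, int_zero,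
    add_zero, (isRational_frac q p).refl_refl]

theorem refl_frac {p q : ℕ} (hp : 0 < p) : refl (frac p q) = frac q p := by
  rcases lt_trichotomy p q with h | rfl | h
  · exact frac_swap_of_lt h
  · rw [frac_of_pos p hp, Nat.mod_self, Nat.div_self hp, frac_zero, refl_one, zero_add, refl_int,
      Nat.cast_one, int_one, vint_one]
  · rw [← frac_swap_of_lt h, (isRational_frac q p).refl_refl]

theorem negFrac_swap_of_lt {p q : ℕ} (h : p < q) : refl (negFrac p q) = negFrac q p := by
  rw [negFrac_of_pos p (by omega), Nat.mod_eq_of_lt h, Nat.div_eq_of_lt h, Nat.cast_zero, neg_zero,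
    int_zero, add_zero, (isRational_negFrac q p).refl_refl]

theorem refl_negFrac {p q : ℕ} (hp : 0 < p) : refl (negFrac p q) = negFrac q p := by
  rcases lt_trichotomy p q with h | rfl | h
  · exact negFrac_swap_of_lt h
  · rw [negFrac_of_pos p hp, Nat.mod_self, Nat.div_self hp, negFrac_zero, refl_one, zero_add,
      refl_int, Nat.cast_one, int_neg_one, vint_neg_one]
  · rw [← negFrac_swap_of_lt h, (isRational_negFrac q p).refl_refl]

theorem refl_frac_eq_int_add {p : ℕ} (hp : 0 < p) (q : ℕ) :
    refl (frac p q) = int (q / p : ℕ) + refl (frac p (q % p)) := by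
  rw [refl_frac hp, frac_of_pos q hp, (isRational_frac _ _).refl.int_add_eq]

theorem refl_negFrac_eq_int_add {p : ℕ} (hp : 0 < p) (q : ℕ) :
    refl (negFrac p q) = int (-(q / p : ℕ)) + refl (negFrac p (q % p)) := by
  rw [refl_negFrac hp, negFrac_of_pos q hp, (isRational_negFrac _ _).refl.int_add_eq]

/-- The identity `-q/p = -1 + (p - q)/p` for rational tangles. -/
theorem refl_negFrac_of_lt {p q : ℕ} (hq : 0 < q) (h : q < p) :
    refl (negFrac p q) = int (-1) + refl (frac p (p - q)) := by
  obtain ⟨r, rfl⟩ := Nat.exists_eq_add_of_lt h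
  set r' := r + 1 with hr
  have e : q + r + 1 = r' + q := by omega
  have e' : r' + q - q = r' := by omega
  -- By `e1` and `e2`, both sides of the goal become `r'/q` with a positive crossing at the bottom
  -- and then a negative one on the right.
  have e1 : frac (r' + q) r' = frac q r' + unit true := by
    rw [add_comm, frac_add_self q (by omega)]
  have e2 : frac (r' + q) q + unit false = frac r' q := by
    have : unit true + unit false = 0 := unit_add_unit true
    rw [frac_add_self r' hq, add_assoc, this, add_zero]
  rw [e, e', refl_negFrac_eq_rot, (isRational_frac _ _).refl.int_add_eq, int_neg_one, e1, refl_add,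
    refl_unit, refl_frac hq, rot, e2]

theorem mk_rationalTangle_of_pos {t : ℚ} (h : 0 < t) :
    mk (rationalTangle t) = frac t.num.natAbs t.den := by
  simp only [rationalTangle, h, if_true]; rfl

theorem mk_rationalTangle_of_nonpos {t : ℚ} (h : ¬ 0 < t) :
    mk (rationalTangle t) = negFrac t.num.natAbs t.den := by
  simp only [rationalTangle, h, if_false]; rfl

theorem mk_rationalTangle_div {p q : ℕ} (hp : 0 < p) (hq : 0 < q) (h : p.Coprime q) :
    mk (rationalTangle (p / q)) = frac p q := by
  have hn : ((p : ℚ) / q).num = p := by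
    have := Rat.num_div_eq_of_coprime (a := (p : ℤ)) (b := q) (by omega) (by simpa using h)
    simpa using this
  have hd : ((p : ℚ) / q).den = q := by
    have := Rat.den_div_eq_of_coprime (a := (p : ℤ)) (b := q) (by omega) (by simpa using h)
    rwa [Int.cast_natCast, Int.cast_natCast, Int.natCast_inj] at this
  rw [mk_rationalTangle_of_pos (by positivity), hn, hd, Int.natAbs_natCast]

/-! ### Splitting off the integral part of one summand -/

/-- The class of the tangle `t0`. -/
def summand (t : ℚ) : TangleClass := refl (mk (rationalTangle t))

theorem isRational_summand (t : ℚ) : IsRational (summand t) := (isRational_contFrac _).refl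

theorem floor_fract_of_eq {x : ℚ} {d : ℤ} {r p : ℕ} (hr : r < p) (h : x = d + r / p) :
    ⌊x⌋ = d ∧ Int.fract x = r / p := by
  have hp : (0 : ℚ) < p := by exact_mod_cast (by omega : 0 < p)
  have h1 : (r : ℚ) / p < 1 := by rw [div_lt_one hp]; exact_mod_cast hr
  have hf : ⌊x⌋ = d := by
    rw [Int.floor_eq_iff, h]
    exact ⟨by linarith [div_nonneg r.cast_nonneg hp.le], by linarith⟩
  refine ⟨hf, ?_⟩
  rw [Int.fract, hf, h]; ring

theorem summand_eq {t : ℚ} (ht : t ≠ 0) :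
    summand t = int ⌊1 / t⌋ + if Int.fract (1 / t) ≠ 0 then summand (hat t) else 0 := by
  set p := t.num.natAbs with hp'
  set q := t.den with hq'
  have hp : 0 < p := Int.natAbs_pos.2 (Rat.num_ne_zero.2 ht)
  have hq : 0 < q := t.den_pos
  have hpq : p.Coprime q := t.reduced
  have hpQ : (p : ℚ) ≠ 0 := by exact_mod_cast hp.ne'
  set r := q % p with hr'
  have hr : r < p := Nat.mod_lt _ hp
  have hqr : (q : ℚ) = p * (q / p : ℕ) + r := by exact_mod_cast (Nat.div_add_mod q p).symm
  have hcop : p.Coprime r := by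
    rw [hr', Nat.Coprime, Nat.gcd_comm, ← Nat.gcd_rec]; exact hpq
  rcases lt_or_gt_of_ne ht with h | h
  · have htn : ¬ 0 < t := by linarith
    have ht' : 1 / t = -(q / p) := by
      have : (p : ℚ) = -t.num := by
        rw [hp', Nat.cast_natAbs, abs_of_neg (Rat.num_neg.2 h)]; push_cast; rfl
      rw [this, div_neg, neg_neg, one_div]
      conv_lhs => rw [← Rat.num_div_den t, inv_div]
    rw [summand, mk_rationalTangle_of_nonpos htn, ← hp', ← hq', refl_negFrac_eq_int_add hp, ← hr']
    generalize q / p = d at hqr ⊢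
    rcases Nat.eq_zero_or_pos r with h0 | h0
    · obtain ⟨h1, h2⟩ := floor_fract_of_eq (x := 1 / t) (d := -(d : ℤ)) (r := 0) hp
        (by rw [ht', hqr, h0]; push_cast; field_simp; simp)
      -- The fraction `p/0` denotes `∞`, whose reflection is `0`: the omitted entry contributes
      -- nothing.
      rw [h1, h2, h0, negFrac_zero, refl_one]
      simp
    -- With a positive remainder, `-(d + r/p)` lies strictly between `-d - 1` and `-d`, so the
    -- fractional part is the complement `(p - r)/p`.
    · obtain ⟨h1, h2⟩ := floor_fract_of_eq (x := 1 / t) (d := -(d : ℤ) + -1) (r := p - r)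
        (p := p) (by omega)
        (by rw [ht', hqr, Nat.cast_sub hr.le]; push_cast; field_simp; ring)
      have h3 : Int.fract (1 / t) ≠ 0 := by
        rw [h2]
        have : ((p - r : ℕ) : ℚ) ≠ 0 := by exact_mod_cast (by omega : p - r ≠ 0)
        positivity
      have h4 : p.Coprime (p - r) := (Nat.coprime_self_sub_right hr.le).2 hcop
      rw [if_pos h3, h1, summand, hat, h2, one_div_div, mk_rationalTangle_div hp (by omega) h4,
        refl_negFrac_of_lt h0 hr, int_add, add_assoc]
  · have ht' : 1 / t = q / p := by
      have : (p : ℚ) = t.num := by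
        rw [hp', Nat.cast_natAbs, abs_of_pos (Rat.num_pos.2 h)]
      rw [this, one_div]
      conv_lhs => rw [← Rat.num_div_den t, inv_div]
    rw [summand, mk_rationalTangle_of_pos h, ← hp', ← hq', refl_frac_eq_int_add hp, ← hr']
    generalize q / p = d at hqr ⊢
    obtain ⟨h1, h2⟩ := floor_fract_of_eq (x := 1 / t) (d := (d : ℤ)) hr
      (by rw [ht', hqr]; push_cast; field_simp)
    rcases Nat.eq_zero_or_pos r with h0 | h0
    · rw [h1, h2, h0, frac_zero, refl_one]
      simp
    · have h3 : Int.fract (1 / t) ≠ 0 := by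
        rw [h2]; positivity
      rw [if_pos h3, h1, summand, hat, h2, one_div_div, mk_rationalTangle_div hp h0 hcop]

/-! ### Montesinos links -/

theorem mk_foldl (ts : List ℚ) (s : Tangle) :
    mk (ts.foldl (fun s t => Tangle.sum s (Tangle.prod (rationalTangle t) Tangle.zero)) s) =
      mk s + (ts.map summand).sum := by
  induction ts generalizing s with
  | nil => simp
  | cons t ts ih =>
    rw [List.foldl_cons, ih, List.map_cons, List.sum_cons, mk_sum, Tangle.prod, mk_sum, mk_reflect,
      mk_zero, add_zero, add_assoc]
    rfl

/-- The integer collected from the tail passes to the left of the reduced head, which is rational,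
by `int_add_eq`. -/
theorem sum_summand (ts : List ℚ) (hts : ∀ t ∈ ts, t ≠ 0) :
    (ts.map summand).sum = int (ts.map fun t => ⌊1 / t⌋).sum +
      (((ts.filter fun t => Int.fract (1 / t) ≠ 0).map hat).map summand).sum := by
  induction ts with
  | nil => simp [int_zero]
  | cons t ts ih =>
    rw [List.map_cons, List.sum_cons, ih fun t ht => hts t (List.mem_cons_of_mem _ ht),
      summand_eq (hts t List.mem_cons_self), List.map_cons, List.sum_cons, int_add]
    by_cases h : Int.fract (1 / t) = 0
    · rw [if_neg (by simpa using h), List.filter_cons_of_neg (by simpa using h), add_zero, add_assoc]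
    · rw [if_pos h, List.filter_cons_of_pos (by simpa using h), List.map_cons, List.map_cons,
        List.sum_cons, add_assoc, ← add_assoc (summand (hat t)),
        ← (isRational_summand (hat t)).int_add_eq]
      simp only [add_assoc]

theorem isotopic_montesinos {e e' : ℤ} {ts ts' : List ℚ}
    (h : int e + (ts.map summand).sum = int e' + (ts'.map summand).sum) :
    Isotopic (montesinos e ts) (montesinos e' ts') := by
  refine Tangle.closure_congr (mk_eq.1 ?_)
  rwa [mk_foldl, mk_foldl, mk_integral, mk_integral]

end TangleClass

end Montesinos

/-- The reduced form of a Montesinos link. If `1/tᵢ` is an integer, then `{1/tᵢ} = 0` and the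
entry `t̂ᵢ = ∞` is omitted on the right-hand side; otherwise nothing is omitted. -/
theorem proposition3p2 (e : ℤ) (ts : List ℚ) (hts : ∀ t ∈ ts, t ≠ 0 ∧ t ≠ 1 ∧ t ≠ -1) :
    Montesinos.Isotopic
      (Montesinos.montesinos e ts)
      (Montesinos.montesinos (Montesinos.epsilon e ts)
        ((ts.filter fun t => Int.fract (1 / t) ≠ 0).map Montesinos.hat)) := by
  refine Montesinos.TangleClass.isotopic_montesinos ?_
  rw [Montesinos.TangleClass.sum_summand ts fun t ht => (hts t ht).1, ← add_assoc,
    ← Montesinos.TangleClass.int_add]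
  rfl
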